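/- For a monoid $M$ generated by a finite set $A$, the word problem of $M$ with respect to $A$ is the language $\{u\# v^{\mathrm{rev}} \mid u,v\in A^*,\ u=_M v\}$, where $\#\notin A$ and $v^{\mathrm{rev}}$ is the reversal of $v$; $M$ is called context-free if it has a finite generating set for which this language is context-free. For an idempotent $e\in M$, the maximal subgroup of $M$ containing $e$ is the group of units of the monoid $eMe$ (whose identity element is $e$). Theorem. Let $\Pi_2$ be the monoid given by the monoid presentation $\langle a,b,c \mid (ab^ic)^2=1\ (i\ge 1)\rangle$. Then the word problem of $\Pi_2$ with respect to $\{a,b,c\}$ is a context-free language, so that $\Pi_2$ is a context-free monoid. Every maximal subgroup of $\Pi_2$ is isomorphic to the group of units of $\Pi_2$, which is not finitely generated. Hence no maximal subgroup of $\Pi_2$ is finitely generated; in particular, there exists a context-free monoid none of whose maximal subgroups is finitely generated, and the group of units of a context-free monoid need not be finitely generated. -/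

import Mathlib

/-- The word problem of a monoid `M` with respect to generators `g : A → M`: the language of all
words `u # vʳᵉᵛ`, where `u` and `v` are words over `A` which represent the same element of `M`.
The alphabet is `Option A`: a letter `x` of `A` is `some x`, and the extra symbol `#` is `none`. -/
def monoidWordProblem {M : Type*} [Monoid M] {A : Type*} (g : A → M) : Language (Option A) :=
  {w | ∃ u v : List A, (u.map g).prod = (v.map g).prod ∧
    w = u.map some ++ none :: v.reverse.map some}

/-- A monoid is context-free if it has a finite generating set with respect to which its word
problem is a context-free language. -/
def IsContextFreeMonoid (M : Type*) [Monoid M] : Prop :=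
  ∃ (A : Type) (_ : Finite A) (g : A → M),
    Submonoid.closure (Set.range g) = ⊤ ∧ (monoidWordProblem g).IsContextFree

/-- For an idempotent `e`, the set `eMe` is a monoid with identity element `e`. -/
instance cornerMonoid {M : Type*} [Monoid M] {e : M} (he : IsIdempotentElem e) :
    Monoid he.Corner where
  __ : Semigroup he.Corner := inferInstanceAs <| Semigroup (Subsemigroup.corner e)
  one := ⟨e, e, by simp only [he.eq]⟩
  one_mul r := Subtype.ext ((Subsemigroup.mem_corner_iff he).mp r.2).1
  mul_one r := Subtype.ext ((Subsemigroup.mem_corner_iff he).mp r.2).2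

/-- The maximal subgroup of `M` containing the idempotent `e`: the group of units of `eMe`. -/
abbrev MaximalSubgroup {M : Type*} [Monoid M] {e : M} (he : IsIdempotentElem e) : Type _ :=
  he.Cornerˣ

/-- The alphabet `{a, b, c}`. -/
inductive Letter : Type
  | a : Letter
  | b : Letter
  | c : Letter

/-- The defining relations `(a bⁱ c)² = 1` for `i ≥ 1`. -/
def piTwoRel (u v : FreeMonoid Letter) : Prop :=
  ∃ i : ℕ, 1 ≤ i ∧
    u = (FreeMonoid.of Letter.a * FreeMonoid.of Letter.b ^ i * FreeMonoid.of Letter.c) ^ 2 ∧ v = 1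

/-- The monoid `Π₂ = Mon⟨a, b, c | (a bⁱ c)² = 1 (i ≥ 1)⟩`. -/
abbrev PiTwo : Type := PresentedMonoid piTwoRel

/-!
The defining relations are read as the length-reducing rewriting system which deletes a factor
`(a bⁱ c)(a bⁱ c)`. Two such factors of a word are disjoint, or equal, or overlap in exactly one
block `a bⁱ c`, so the system is confluent (`Step.diamond`), and two words are equal in `Π₂` iff
they have a common descendant (`toPi_eq_iff_join`).

*Context-freeness.* A word rewrites to `x₁ ⋯ xₙ` iff it is `E₀ x₁ E₁ ⋯ xₙ Eₙ`, where each `Eᵢ`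
rewrites to the empty word (`Red.expansion`). Hence the word problem reduces to generating the
words that are equal to `1` and their reversals. A nonempty one among them is an expansion of
`a bⁱ c a bⁱ c`, in which the two powers of `b` are nested around `c a`, so that a context-free
grammar can match them.

*Maximal subgroups.* Let `w` be the irreducible word of an idempotent. Deleting redexes across the
junction of `w w` leaves an irreducible `x x'` with `w = x y = y' x'` and `y y' = 1`; as this word
is `w` again, `y = x'` and `y' = x`. So the idempotent is `q p` with `p q = 1`
(`exists_eq_mul_of_isIdempotentElem`), and `m ↦ q m p` identifies `Π₂` with the corner at it.

*The group of units.* `Π₂` acts by partial maps on pairs of a vector over `ZMod 2` and a stack of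
natural numbers: `c` pushes `0`, `b` increments the top, `a` pops the top `n` and adds the `n`-th
unit vector. Units must leave the stack alone, so each of them translates the vector by a fixed
finitely supported one, and `a bⁱ c` translates by the `i`-th unit vector. Finitely many units only
reach finitely many coordinates.
-/

open Relation

/-! ### The rewriting system -/

/-- The word `a bⁱ c`. -/
def block (i : ℕ) : List Letter := Letter.a :: (List.replicate i Letter.b ++ [Letter.c])

/-- One rewriting step: the deletion of a factor `(a bⁱ c)²` with `i ≥ 1`. -/
inductive Step : List Letter → List Letter → Prop
  | intro (i : ℕ) (hi : 1 ≤ i) (p q : List Letter) :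
      Step (p ++ (block i ++ (block i ++ q))) (p ++ q)

/-- Rewriting in finitely many steps. -/
abbrev Red : List Letter → List Letter → Prop := ReflTransGen Step

/-- A word is irreducible if no rewriting step applies to it. -/
def Irred (w : List Letter) : Prop := ∀ w', ¬ Step w w'

lemma Step.context {u v : List Letter} (h : Step u v) (p q : List Letter) :
    Step (p ++ u ++ q) (p ++ v ++ q) := by
  obtain ⟨i, hi, p', q'⟩ := h
  simpa using Step.intro i hi (p ++ p') (q' ++ q)

lemma Step.length_lt {u v : List Letter} (h : Step u v) : v.length < u.length := by
  obtain ⟨i, hi, p, q⟩ := h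
  simp [block]
  omega

lemma Red.context {u v : List Letter} (h : Red u v) (p q : List Letter) :
    Red (p ++ u ++ q) (p ++ v ++ q) :=
  h.lift (fun w => p ++ w ++ q) fun _ _ h => h.context p q

lemma Red.append {u v u' v' : List Letter} (h : Red u v) (h' : Red u' v') :
    Red (u ++ u') (v ++ v') := by
  have h1 := h.context [] u'
  have h2 := h'.context v []
  simp only [List.nil_append, List.append_nil] at h1 h2
  exact h1.trans h2

lemma replicate_append_c_inj {i j : ℕ} {q q' : List Letter}
    (h : List.replicate i Letter.b ++ Letter.c :: q = List.replicate j Letter.b ++ Letter.c :: q') :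
    i = j ∧ q = q' := by
  induction i generalizing j with
  | zero => cases j <;> simp_all [List.replicate_succ]
  | succ i ih =>
    cases j with
    | zero => simp [List.replicate_succ] at h
    | succ j =>
      simp only [List.replicate_succ, List.cons_append, List.cons.injEq, true_and] at h
      simpa using ih h

lemma block_append_inj {i j : ℕ} {q q' : List Letter} (h : block i ++ q = block j ++ q') :
    i = j ∧ q = q' := by
  simp only [block, List.cons_append, List.append_assoc, List.nil_append, List.cons.injEq,
    true_and] at h
  exact replicate_append_c_inj h

lemma replicate_append_c_eq_append_a {i : ℕ} {q r s : List Letter}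
    (h : List.replicate i Letter.b ++ Letter.c :: q = r ++ Letter.a :: s) :
    ∃ t, r = List.replicate i Letter.b ++ Letter.c :: t ∧ q = t ++ Letter.a :: s := by
  induction i generalizing r with
  | zero => cases r <;> simp_all
  | succ i ih =>
    cases r with
    | nil => simp [List.replicate_succ] at h
    | cons x r =>
      simp only [List.replicate_succ, List.cons_append, List.cons.injEq] at h
      obtain ⟨t, rfl, hq⟩ := ih h.2
      exact ⟨t, by simp [List.replicate_succ, h.1], hq⟩

/-- In `a bⁱ c` the letter `a` occurs only at the start. -/
lemma block_append_eq_append_a {i : ℕ} {q r s : List Letter}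
    (h : block i ++ q = r ++ Letter.a :: s) :
    r = [] ∨ ∃ t, r = block i ++ t ∧ q = t ++ Letter.a :: s := by
  cases r with
  | nil => exact .inl rfl
  | cons x r =>
    simp only [block, List.cons_append, List.append_assoc, List.nil_append,
      List.cons.injEq] at h
    obtain ⟨t, rfl, hq⟩ := replicate_append_c_eq_append_a h.2
    exact .inr ⟨t, by simp [block, h.1], hq⟩

lemma redex_overlap {i j : ℕ} {q r q' : List Letter}
    (h : block i ++ (block i ++ q) = r ++ (block j ++ (block j ++ q'))) :
    q = r ++ q' ∨ ∃ t, r = block i ++ (block i ++ t) ∧ q = t ++ (block j ++ (block j ++ q')) := by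
  rcases block_append_eq_append_a h with rfl | ⟨t, rfl, h'⟩
  · obtain ⟨rfl, h⟩ := block_append_inj h
    exact .inl (block_append_inj h).2
  · rcases block_append_eq_append_a h' with rfl | ⟨t, rfl, h''⟩
    · obtain ⟨rfl, h⟩ := block_append_inj h'
      exact .inl (by simpa using h)
    · exact .inr ⟨t, rfl, h''⟩

lemma Step.diamond {u v w : List Letter} (hv : Step u v) (hw : Step u w) :
    v = w ∨ ∃ d, Step v d ∧ Step w d := by
  obtain ⟨i, hi, p, q⟩ := hv
  generalize hu : p ++ (block i ++ (block i ++ q)) = u at hw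
  obtain ⟨j, hj, p', q'⟩ := hw
  rcases List.append_eq_append_iff.mp hu with ⟨r, rfl, h⟩ | ⟨r, rfl, h⟩
  · rcases redex_overlap h with rfl | ⟨t, rfl, rfl⟩
    · exact .inl (by simp)
    · refine .inr ⟨p ++ t ++ q', ?_, ?_⟩
      · simpa using Step.intro j hj (p ++ t) q'
      · simpa using Step.intro i hi p (t ++ q')
  · rcases redex_overlap h with rfl | ⟨t, rfl, rfl⟩
    · exact .inl (by simp)
    · refine .inr ⟨p' ++ t ++ q, ?_, ?_⟩
      · simpa using Step.intro j hj p' (t ++ q)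
      · simpa using Step.intro i hi (p' ++ t) q

lemma Step.local_church_rosser (a b c : List Letter) (hb : Step a b) (hc : Step a c) :
    ∃ d, ReflGen Step b d ∧ Red c d := by
  rcases hb.diamond hc with rfl | ⟨d, hbd, hcd⟩
  · exact ⟨b, .refl, .refl⟩
  · exact ⟨d, .single hbd, .single hcd⟩

lemma Irred.eq_of_red {u v : List Letter} (hu : Irred u) (h : Red u v) : v = u := by
  rcases h.cases_head with h | ⟨w, hw, -⟩
  · exact h.symm
  · exact absurd hw (hu w)

lemma exists_red_irred (u : List Letter) : ∃ v, Red u v ∧ Irred v := by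
  induction h : u.length using Nat.strong_induction_on generalizing u with
  | _ n ih =>
    by_cases hu : Irred u
    · exact ⟨u, .refl, hu⟩
    · simp only [Irred, not_forall, not_not] at hu
      obtain ⟨u', hu'⟩ := hu
      obtain ⟨v, hv, hv'⟩ := ih _ (h ▸ hu'.length_lt) u' rfl
      exact ⟨v, hv.head hu', hv'⟩

/-! ### Words and elements of the monoid -/

/-- The element of `Π₂` represented by a word. -/
def toPi (u : List Letter) : PiTwo := PresentedMonoid.mk piTwoRel (FreeMonoid.ofList u)

@[simp] lemma toPi_nil : toPi [] = 1 := rfl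

@[simp] lemma toPi_append (u v : List Letter) : toPi (u ++ v) = toPi u * toPi v := rfl

lemma toPi_cons (x : Letter) (u : List Letter) :
    toPi (x :: u) = PresentedMonoid.of piTwoRel x * toPi u := rfl

lemma prod_map_of (u : List Letter) : (u.map (PresentedMonoid.of piTwoRel)).prod = toPi u := by
  induction u with
  | nil => rfl
  | cons x u ih => rw [List.map_cons, List.prod_cons, ih, toPi_cons]

lemma toPi_surjective : Function.Surjective toPi := fun m => by
  obtain ⟨w, rfl⟩ := PresentedMonoid.surjective_mk m
  exact ⟨w.toList, rfl⟩

lemma ofList_replicate_b (i : ℕ) :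
    FreeMonoid.ofList (List.replicate i Letter.b) = FreeMonoid.of Letter.b ^ i := by
  induction i with
  | zero => rfl
  | succ i ih => rw [List.replicate_succ, pow_succ', ← ih]; rfl

lemma ofList_block (i : ℕ) : FreeMonoid.ofList (block i) =
    FreeMonoid.of Letter.a * FreeMonoid.of Letter.b ^ i * FreeMonoid.of Letter.c := by
  rw [← ofList_replicate_b]; rfl

lemma toPi_block_mul_self {i : ℕ} (hi : 1 ≤ i) : toPi (block i) * toPi (block i) = 1 := by
  rw [toPi, ← map_mul, ofList_block, ← pow_two]
  exact PresentedMonoid.mk_eq_mk_of_rel ⟨i, hi, rfl, rfl⟩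

lemma Step.toPi_eq {u v : List Letter} (h : Step u v) : toPi u = toPi v := by
  obtain ⟨i, hi, p, q⟩ := h
  simp only [toPi_append]
  rw [← mul_assoc (toPi (block i)), toPi_block_mul_self hi, one_mul]

lemma Red.toPi_eq {u v : List Letter} (h : Red u v) : toPi u = toPi v := by
  induction h with
  | refl => rfl
  | tail _ h ih => exact ih.trans h.toPi_eq

/-- The congruence on the free monoid which identifies words with a common descendant. -/
def joinCon : Con (FreeMonoid Letter) where
  r u v := Join Red u.toList v.toList
  iseqv :=
    have h := equivalence_join_reflTransGen Step.local_church_rosser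
    ⟨fun _ => h.refl _, fun h' => h.symm h', fun h' h'' => h.trans h' h''⟩
  mul' := by
    rintro w x y z ⟨d, hw, hx⟩ ⟨d', hy, hz⟩
    exact ⟨d ++ d', hw.append hy, hx.append hz⟩

lemma toPi_eq_iff_join {u v : List Letter} : toPi u = toPi v ↔ Join Red u v := by
  constructor
  · intro h
    have hle : conGen piTwoRel ≤ joinCon := by
      rw [Con.conGen_le]
      rintro x y ⟨i, hi, rfl, rfl⟩
      rw [← ofList_block, pow_two]
      exact ⟨[], .single (by simpa using Step.intro i hi [] []), .refl⟩
    exact hle (PresentedMonoid.mk_eq_mk_iff.mp h)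
  · rintro ⟨d, hu, hv⟩
    exact hu.toPi_eq.trans hv.toPi_eq.symm

lemma red_of_toPi_eq {u v : List Letter} (hv : Irred v) (h : toPi u = toPi v) : Red u v := by
  obtain ⟨d, hu, hd⟩ := toPi_eq_iff_join.mp h
  rwa [hv.eq_of_red hd] at hu

/-! ### Idempotents and maximal subgroups -/

lemma Irred.of_append_left {u v : List Letter} (h : Irred (u ++ v)) : Irred u :=
  fun w hw => h (w ++ v) (by simpa using hw.context [] v)

lemma Irred.of_append_right {u v : List Letter} (h : Irred (u ++ v)) : Irred v :=
  fun w hw => h (u ++ w) (by simpa using hw.context u [])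

/-- A redex of a product of two irreducible words straddles the junction. -/
lemma Step.straddle {x x' z : List Letter} (hx : Irred x) (hx' : Irred x')
    (h : Step (x ++ x') z) :
    ∃ p s t q, x = p ++ s ∧ x' = t ++ q ∧ z = p ++ q ∧ toPi s * toPi t = 1 := by
  generalize hu : x ++ x' = u at h
  obtain ⟨i, hi, p, q⟩ := h
  rw [← List.append_assoc (block i)] at hu
  rcases List.append_eq_append_iff.mp hu with ⟨r, rfl, h⟩ | ⟨r, rfl, h⟩
  · exact absurd (Step.intro i hi r q) (by simpa [h] using hx' _)
  · rcases List.append_eq_append_iff.mp h with ⟨t, h1, h2⟩ | ⟨t, h1, h2⟩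
    · exact absurd (Step.intro i hi p t) (by simpa [h1] using hx _)
    · refine ⟨p, r, t, q, rfl, h2, rfl, ?_⟩
      rw [← toPi_append, ← h1, toPi_append, toPi_block_mul_self hi]

/-- Rewriting a product of two irreducible words cancels a suffix of the first one against a
prefix of the second one. -/
lemma exists_cancellation {u v : List Letter} (hu : Irred u) (hv : Irred v) :
    ∃ x y y' x', u = x ++ y ∧ v = y' ++ x' ∧ toPi y * toPi y' = 1 ∧ Irred (x ++ x') := by
  induction h : u.length + v.length using Nat.strong_induction_on generalizing u v with
  | _ n ih =>
    by_cases huv : Irred (u ++ v)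
    · exact ⟨u, [], [], v, by simp, by simp, by simp, huv⟩
    · simp only [Irred, not_forall, not_not] at huv
      obtain ⟨z, hz⟩ := huv
      have hlt := hz.length_lt
      obtain ⟨p, s, t, q, rfl, rfl, rfl, hst⟩ := hz.straddle hu hv
      obtain ⟨x, y, y', x', rfl, rfl, hy, hx⟩ :=
        ih (p.length + q.length) (by simp at hlt h; omega)
          hu.of_append_left hv.of_append_right rfl
      refine ⟨x, y ++ s, t ++ y', x', by simp, by simp, ?_, hx⟩
      rw [toPi_append, toPi_append, mul_assoc, ← mul_assoc (toPi s), hst, one_mul, hy]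

/-- Every idempotent of `Π₂` is `q p` with `p q = 1`, so that it is `𝒟`-equivalent to `1`. -/
lemma exists_eq_mul_of_isIdempotentElem {e : PiTwo} (he : IsIdempotentElem e) :
    ∃ p q : PiTwo, p * q = 1 ∧ e = q * p := by
  obtain ⟨u, rfl⟩ := toPi_surjective e
  obtain ⟨w, huw, hw⟩ := exists_red_irred u
  rw [huw.toPi_eq] at he ⊢
  -- Idempotency turns the two factorizations of `w` into one, because `x x'` must be `w` again.
  obtain ⟨x, y, y', x', hxy, hyx', hy, hx⟩ := exists_cancellation hw hw
  have hval : toPi (x ++ x') = toPi w :=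
    calc toPi (x ++ x') = toPi x * (toPi y * toPi y') * toPi x' := by
          rw [hy, mul_one, toPi_append]
      _ = toPi (x ++ y) * toPi (y' ++ x') := by simp only [toPi_append, mul_assoc]
      _ = toPi w := by rw [← hxy, ← hyx', he.eq]
  have hxx : w = x ++ x' := hx.eq_of_red (red_of_toPi_eq hw hval)
  obtain rfl : y = x' := List.append_cancel_left (hxy.symm.trans hxx)
  obtain rfl : y' = x := List.append_cancel_right (hyx'.symm.trans hxx)
  exact ⟨toPi y, toPi y', hy, by rw [hxy, toPi_append]⟩

/-- If `p q = 1`, then `m ↦ q m p` is an isomorphism from `M` onto the corner at `q p`. -/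
def cornerEquiv {M : Type*} [Monoid M] {p q : M} (he : IsIdempotentElem (q * p))
    (hpq : p * q = 1) : M ≃* he.Corner where
  toFun m := ⟨q * m * p, (Subsemigroup.mem_corner_iff he).mpr
    ⟨by rw [← mul_assoc, ← mul_assoc, mul_assoc q, hpq, mul_one],
      by rw [← mul_assoc, mul_assoc _ p, hpq, mul_one]⟩⟩
  invFun x := p * x.1 * q
  left_inv m := by
    simp only [mul_assoc, hpq, mul_one]
    rw [← mul_assoc, hpq, one_mul]
  right_inv x := by
    have hx := (Subsemigroup.mem_corner_iff he).mp x.2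
    apply Subtype.ext
    simp only [← mul_assoc]
    rw [mul_assoc _ q p, hx.1, hx.2]
  map_mul' m n := Subtype.ext <| by
    change q * (m * n) * p = q * m * p * (q * n * p)
    simp only [← mul_assoc]
    rw [mul_assoc _ p q, hpq, mul_one]

/-! ### The group of units is not finitely generated -/

/-- States of the machine on which `Π₂` acts: a finitely supported vector over `ZMod 2` and a stack
of natural numbers. -/
abbrev StackState : Type := (ℕ →₀ ZMod 2) × List ℕ

/-- The partial action of the letters: `c` pushes `0`, `b` increments the top of the stack, and `a`
pops the top `n` of the stack and adds the `n`-th unit vector. The maps for `a` and `b` are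
undefined on the empty stack. -/
noncomputable def letterStep : Letter → StackState → Option StackState
  | .a, (f, n :: l) => some (f + Finsupp.single n 1, l)
  | .b, (f, n :: l) => some (f, (n + 1) :: l)
  | .c, (f, l) => some (f, 0 :: l)
  | _, (_, []) => none

/-- The action of a letter, with `none` for an undefined state. -/
noncomputable def letterEnd (x : Letter) : Function.End (Option StackState) :=
  fun o => o.bind (letterStep x)

lemma end_mul_apply {α : Type*} (f g : Function.End α) (x : α) :
    (f * g) x = f (g x) := rfl

lemma end_one_apply {α : Type*} (x : α) : (1 : Function.End α) x = x := rfl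

lemma letterEnd_b_pow (i : ℕ) (f : ℕ →₀ ZMod 2) (n : ℕ) (l : List ℕ) :
    (letterEnd .b ^ i) (some (f, n :: l)) = some (f, (n + i) :: l) := by
  induction i with
  | zero => rfl
  | succ i ih =>
    rw [pow_succ', end_mul_apply, ih]
    rfl

lemma letterEnd_block (i : ℕ) (f : ℕ →₀ ZMod 2) (l : List ℕ) :
    (letterEnd .a * letterEnd .b ^ i * letterEnd .c) (some (f, l)) =
      some (f + Finsupp.single i 1, l) := by
  have h := letterEnd_b_pow i f 0 l
  rw [zero_add] at h
  change letterEnd .a ((letterEnd .b ^ i) (some (f, 0 :: l))) = _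
  rw [h]
  rfl

lemma letterEnd_list_none (w : List Letter) : (w.map letterEnd).prod none = none := by
  induction w with
  | nil => rfl
  | cons x w ih =>
    rw [List.map_cons, List.prod_cons, end_mul_apply, ih]
    rfl

lemma lift_letterEnd (w : FreeMonoid Letter) :
    FreeMonoid.lift letterEnd w = (w.toList.map letterEnd).prod := FreeMonoid.lift_apply _ _

/-- The action of `Π₂` on the states of the machine. -/
noncomputable def stackAction : PiTwo →* Function.End (Option StackState) :=
  PresentedMonoid.lift letterEnd <| by
    rintro u v ⟨i, -, rfl, rfl⟩
    funext o
    cases o with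
    | none => rw [lift_letterEnd, letterEnd_list_none]; rfl
    | some s =>
      simp only [map_pow, map_mul, FreeMonoid.lift_eval_of, map_one, pow_two]
      rw [end_mul_apply, letterEnd_block, letterEnd_block, add_assoc,
        ← Finsupp.single_add, CharTwo.add_self_eq_zero, Finsupp.single_zero, add_zero]
      rfl

lemma stackAction_mul_apply (m n : PiTwo) (s : Option StackState) :
    stackAction (m * n) s = stackAction m (stackAction n s) := by
  rw [map_mul, end_mul_apply]

lemma stackAction_toPi (w : List Letter) : stackAction (toPi w) = (w.map letterEnd).prod :=
  lift_letterEnd (FreeMonoid.ofList w)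

lemma stackAction_none (m : PiTwo) : stackAction m none = none := by
  obtain ⟨w, rfl⟩ := toPi_surjective m
  rw [stackAction_toPi, letterEnd_list_none]

/-- A computation that succeeds on the empty stack does not look below the given stack. -/
lemma stackAction_extend {m : PiTwo} {d : ℕ →₀ ZMod 2} {k : List ℕ}
    (h : stackAction m (some (0, [])) = some (d, k)) (f : ℕ →₀ ZMod 2) (l : List ℕ) :
    stackAction m (some (f, l)) = some (f + d, k ++ l) := by
  obtain ⟨w, rfl⟩ := toPi_surjective m
  rw [stackAction_toPi] at h ⊢
  induction w generalizing d k with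
  | nil =>
    cases h
    simp [end_one_apply]
  | cons x w ih =>
    rw [List.map_cons, List.prod_cons, end_mul_apply] at h ⊢
    cases hw : (w.map letterEnd).prod (some (0, [])) with
    | none => rw [hw] at h; cases h
    | some s =>
      obtain ⟨d', k'⟩ := s
      rw [hw] at h
      rw [ih hw]
      cases x <;> cases k' <;> simp_all [letterEnd, letterStep]
      all_goals (obtain ⟨rfl, rfl⟩ := h; simp [add_assoc])

lemma exists_translation (u : PiTwoˣ) :
    ∃ d : ℕ →₀ ZMod 2, ∀ f l, stackAction u (some (f, l)) = some (f + d, l) := by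
  have hinv (v : PiTwoˣ) (s) : stackAction v (stackAction (v⁻¹ : PiTwoˣ) s) = s := by
    rw [← stackAction_mul_apply,
      Units.mul_inv, map_one]
    rfl
  have hsome (v : PiTwoˣ) : ∃ d k, stackAction v (some (0, [])) = some (d, k) := by
    cases hv : stackAction v (some (0, [])) with
    | none =>
      have := hinv v⁻¹ (some (0, []))
      rw [inv_inv, hv, stackAction_none] at this
      cases this
    | some s => exact ⟨s.1, s.2, rfl⟩
  obtain ⟨d, k, hu⟩ := hsome u
  obtain ⟨d', k', hu'⟩ := hsome u⁻¹
  have h := hinv u (some (0, []))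
  rw [hu', stackAction_extend hu] at h
  obtain rfl : k = [] := by simp at h; exact h.2.1
  exact ⟨d, fun f l => by simpa using stackAction_extend hu f l⟩

/-- The units which fix the coordinates from `N` on. -/
def boundedUnits (N : ℕ) : Subgroup PiTwoˣ where
  carrier := {u | ∃ d : ℕ →₀ ZMod 2, (∀ n, N ≤ n → d n = 0) ∧
    ∀ f l, stackAction u (some (f, l)) = some (f + d, l)}
  one_mem' := ⟨0, by simp, fun f l => by simp [end_one_apply]⟩
  mul_mem' := by
    rintro u v ⟨d, hd, hu⟩ ⟨d', hd', hv⟩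
    refine ⟨d' + d, fun n hn => by simp [hd n hn, hd' n hn], fun f l => ?_⟩
    rw [Units.val_mul, stackAction_mul_apply, hv, hu, add_assoc]
  inv_mem' := by
    rintro u ⟨d, hd, hu⟩
    refine ⟨-d, fun n hn => by simp [hd n hn], fun f l => ?_⟩
    have h := hu (f + -d) l
    rw [neg_add_cancel_right] at h
    rw [← h, ← stackAction_mul_apply,
      Units.inv_mul, map_one]
    rfl

/-- The involution `a bⁱ c` as a unit. -/
def blockUnit (i : ℕ) (hi : 1 ≤ i) : PiTwoˣ where
  val := toPi (block i)
  inv := toPi (block i)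
  val_inv := toPi_block_mul_self hi
  inv_val := toPi_block_mul_self hi

lemma not_fg_units : ¬ Group.FG PiTwoˣ := by
  rintro ⟨S, hS⟩
  choose d hd using exists_translation
  obtain ⟨N, hN⟩ : ∃ N, ∀ u ∈ S, ∀ n ∈ (d u).support, n < N :=
    ⟨(S.biUnion fun u => (d u).support).sup id + 1, fun u hu n hn => Nat.lt_succ_of_le <|
      Finset.le_sup (f := id) (Finset.mem_biUnion.mpr ⟨u, hu, hn⟩)⟩
  have hle : Subgroup.closure (S : Set PiTwoˣ) ≤ boundedUnits N := by
    rw [Subgroup.closure_le]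
    intro u hu
    refine ⟨d u, fun n hn => ?_, hd u⟩
    by_contra h
    exact absurd (hN u hu n (Finsupp.mem_support_iff.mpr h)) (by omega)
  obtain ⟨d', hd', h⟩ : blockUnit (N + 1) (by omega) ∈ boundedUnits N := by
    rw [hS] at hle
    exact hle trivial
  have h1 : stackAction (toPi (block (N + 1))) (some (0, [])) =
      some (0 + Finsupp.single (N + 1) 1, []) := by
    rw [← letterEnd_block, toPi, ofList_block]
    simp only [map_mul, map_pow]
    rfl
  have h2 := h1.symm.trans (h 0 [])
  simp only [zero_add, Option.some.injEq, Prod.mk.injEq, and_true] at h2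
  have h3 := hd' (N + 1) (by omega)
  simp [← h2] at h3

/-! ### Expansions of words -/

/-- `Expansion w u`: the word `u` arises from `w = x₁ ⋯ xₙ` by inserting words that rewrite to the
empty word, one in each of the `n + 1` gaps. -/
inductive Expansion : List Letter → List Letter → Prop
  | nil {e : List Letter} (he : Red e []) : Expansion [] e
  | cons {e w u : List Letter} (x : Letter) (he : Red e []) (h : Expansion w u) :
      Expansion (x :: w) (e ++ x :: u)

lemma Expansion.refl (w : List Letter) : Expansion w w := by
  induction w with
  | nil => exact .nil .refl
  | cons x w ih => exact .cons (e := []) x .refl ih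

lemma Expansion.insert {w p q : List Letter} (h : Expansion w (p ++ q)) {i : ℕ} (hi : 1 ≤ i) :
    Expansion w (p ++ (block i ++ (block i ++ q))) := by
  generalize hu : p ++ q = u at h
  induction h generalizing p q with
  | nil he => exact .nil (he.head (hu ▸ Step.intro i hi p q))
  | @cons e w u x he h ih =>
    rcases List.append_eq_append_iff.mp hu with ⟨r, rfl, rfl⟩ | ⟨r, rfl, h'⟩
    · simpa using Expansion.cons x (he.head (Step.intro i hi p r)) h
    · cases r with
      | nil =>
        obtain rfl : x :: u = q := by simpa using h'
        have hs : Step (e ++ (block i ++ block i)) e := by simpa using Step.intro i hi e []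
        have := Expansion.cons x (he.head hs) h
        simpa using this
      | cons y r =>
        obtain ⟨rfl, rfl⟩ : x = y ∧ u = r ++ q := by simpa using h'
        simpa using Expansion.cons x he (ih rfl)

lemma Red.expansion {u w : List Letter} (h : Red u w) : Expansion w u := by
  induction h using ReflTransGen.head_induction_on with
  | refl => exact .refl w
  | head h _ ih =>
    obtain ⟨i, hi, p, q⟩ := h
    exact ih.insert hi

lemma Expansion.of_cons {x : Letter} {w u : List Letter} (h : Expansion (x :: w) u) :
    ∃ e u', u = e ++ x :: u' ∧ Red e [] ∧ Expansion w u' := by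
  cases h with
  | cons _ he h => exact ⟨_, _, rfl, he, h⟩

lemma Expansion.of_concat {x : Letter} {w u : List Letter} (h : Expansion (w ++ [x]) u) :
    ∃ e u', u = u' ++ x :: e ∧ Red e [] ∧ Expansion w u' := by
  induction w generalizing u with
  | nil =>
    obtain ⟨e, u', rfl, he, h⟩ := h.of_cons
    cases h with
    | nil he' => exact ⟨u', e, rfl, he', .nil he⟩
  | cons y w ih =>
    obtain ⟨e, u', rfl, he, h⟩ := Expansion.of_cons h
    obtain ⟨e', u'', rfl, he', h'⟩ := ih h
    exact ⟨e', e ++ y :: u'', by simp, he', .cons y he h'⟩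

lemma Expansion.of_nil {u : List Letter} (h : Expansion [] u) : Red u [] := by
  cases h with
  | nil he => exact he

/-! ### Generating languages by grammars -/

section Grammar

variable {T : Type*} {g : ContextFreeGrammar T}

/-- The language described by a symbol, given a language for each nonterminal. -/
def symbolLang {N : Type*} (L : N → Language T) : Symbol T N → Language T
  | .terminal t => {[t]}
  | .nonterminal n => L n

/-- If every rule is valid for an interpretation of the nonterminals by languages, then every word
of the grammar lies in the language which interprets the initial symbol. -/
lemma ContextFreeGrammar.language_le_of_rules (L : g.NT → Language T)
    (h : ∀ r ∈ g.rules, (r.output.map (symbolLang L)).prod ≤ L r.input) :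
    g.language ≤ L g.initial := by
  have hstep : ∀ {u v : List (Symbol T g.NT)}, g.Derives u v →
      (v.map (symbolLang L)).prod ≤ (u.map (symbolLang L)).prod := by
    intro u v huv
    induction huv with
    | refl => exact le_rfl
    | tail _ hp ih =>
      obtain ⟨r, hr, hrw⟩ := hp
      obtain ⟨p, q, rfl, rfl⟩ := hrw.exists_parts
      refine le_trans ?_ ih
      simp only [List.map_append, List.prod_append, List.map_cons, List.map_nil,
        List.prod_cons, List.prod_nil, mul_one]
      gcongr
      exact h r hr
  intro w hw
  have hterm : w ∈ ((w.map (Symbol.terminal (N := g.NT))).map (symbolLang L)).prod := by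
    clear hw
    induction w with
    | nil => exact Language.nil_mem_one
    | cons t w ih => exact Language.mem_mul.mpr ⟨[t], rfl, w, ih, rfl⟩
  simpa [symbolLang] using hstep hw hterm

/-- The sentential form `α` derives the word `w`. -/
def ContextFreeGrammar.Yields (g : ContextFreeGrammar T) (α : List (Symbol T g.NT))
    (w : List T) : Prop :=
  g.Derives α (w.map Symbol.terminal)

namespace ContextFreeGrammar.Yields

lemma nil : g.Yields [] [] := Derives.refl _

lemma append {α β : List (Symbol T g.NT)} {u v : List T} (hu : g.Yields α u)
    (hv : g.Yields β v) : g.Yields (α ++ β) (u ++ v) := by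
  rw [Yields, List.map_append]
  exact (hu.append_right β).trans (hv.append_left _)

lemma terminal (t : T) {α : List (Symbol T g.NT)} {w : List T} (hw : g.Yields α w) :
    g.Yields (.terminal t :: α) (t :: w) :=
  Derives.append_left hw [.terminal t]

lemma nonterminal {n : g.NT} {α : List (Symbol T g.NT)} {u w : List T}
    (hu : g.Yields [.nonterminal n] u) (hw : g.Yields α w) :
    g.Yields (.nonterminal n :: α) (u ++ w) :=
  hu.append hw

lemma rule {n : g.NT} {α : List (Symbol T g.NT)} {w : List T} (hr : ⟨n, α⟩ ∈ g.rules)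
    (hw : g.Yields α w) : g.Yields [.nonterminal n] w :=
  Produces.trans_derives ⟨_, hr, ContextFreeRule.Rewrites.input_output⟩ hw

end ContextFreeGrammar.Yields

end Grammar

/-! ### A grammar for the word problem -/

/-- The word `bⁿ c a bⁿ`. -/
def coreWord (n : ℕ) : List Letter :=
  List.replicate n Letter.b ++ Letter.c :: Letter.a :: List.replicate n Letter.b

lemma coreWord_succ (n : ℕ) : coreWord (n + 1) = .b :: (coreWord n ++ [.b]) := by
  rw [coreWord, coreWord]
  conv_lhs => arg 2; rw [List.replicate_succ']
  simp [List.replicate_succ]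

lemma block_append_block (i : ℕ) : block i ++ block i = .a :: (coreWord i ++ [.c]) := by
  simp [block, coreWord]

/-- The nonterminals of the grammar for the word problem. The words before `#` are read forwards and
those after it backwards; the Boolean is `true` for the backward copies, which generate the
reversals of the words described. -/
inductive WordNT : Type
  /-- The word problem itself. -/
  | start : WordNT
  /-- The words equal to `1`. -/
  | null (s : Bool) : WordNT
  /-- The words equal to some `bⁿ c a bⁿ` with `n ≥ 1`. -/
  | core (s : Bool) : WordNT
  /-- The words equal to some `bⁿ c a bⁿ` with `n ≥ 0`. -/
  | inner (s : Bool) : WordNT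

/-- The letter that opens a block, in the given reading direction. -/
def openLetter (s : Bool) : Letter := if s then .c else .a

/-- The letter that closes a block, in the given reading direction. -/
def closeLetter (s : Bool) : Letter := if s then .a else .c

/-- A letter as a symbol of the grammar. -/
def letterSym (x : Letter) : Symbol (Option Letter) WordNT := .terminal (some x)

/-- The rules for the nonterminals of a given reading direction. -/
def directedRules (s : Bool) : List (ContextFreeRule (Option Letter) WordNT) :=
  [⟨.null s, []⟩,
    ⟨.null s, [.nonterminal (.null s), letterSym (openLetter s), .nonterminal (.core s),
      letterSym (closeLetter s), .nonterminal (.null s)]⟩,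
    ⟨.core s, [.nonterminal (.null s), letterSym .b, .nonterminal (.inner s), letterSym .b,
      .nonterminal (.null s)]⟩,
    ⟨.inner s, [.nonterminal (.core s)]⟩,
    ⟨.inner s, [.nonterminal (.null s), letterSym (closeLetter s), .nonterminal (.null s),
      letterSym (openLetter s), .nonterminal (.null s)]⟩]

/-- The rule which puts the same letter on both sides of `#`. -/
def letterRule (x : Letter) : ContextFreeRule (Option Letter) WordNT :=
  ⟨.start, [letterSym x, .nonterminal .start, letterSym x]⟩

/-- The rules for the initial symbol. -/
def startRules : List (ContextFreeRule (Option Letter) WordNT) :=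
  [⟨.start, [.terminal none]⟩,
    ⟨.start, [.nonterminal (.null false), .nonterminal .start, .nonterminal (.null true)]⟩,
    letterRule .a, letterRule .b, letterRule .c]

open Classical in
/-- The rules of the grammar for the word problem. -/
noncomputable def wordRules : Finset (ContextFreeRule (Option Letter) WordNT) :=
  (startRules ++ directedRules false ++ directedRules true).toFinset

/-- The grammar which generates the word problem of `Π₂`. -/
noncomputable def wordGrammar : ContextFreeGrammar (Option Letter) where
  NT := WordNT
  initial := .start
  rules := wordRules

lemma mem_wordGrammar_rules {r : ContextFreeRule (Option Letter) WordNT} :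
    r ∈ wordGrammar.rules ↔ r ∈ startRules ∨ ∃ s, r ∈ directedRules s := by
  change r ∈ wordRules ↔ _
  simp only [wordRules, List.mem_toFinset, List.mem_append, or_assoc, Bool.exists_bool]

lemma letterRule_mem (x : Letter) : letterRule x ∈ startRules := by
  cases x <;> simp [startRules]

lemma core_rule_mem (s : Bool) : ⟨.inner s, [.nonterminal (.core s)]⟩ ∈ directedRules s := by
  simp [directedRules]

/-- The word `u` over the alphabet with `#`, in the given reading direction. -/
def encode (s : Bool) (u : List Letter) : List (Option Letter) :=
  (if s then u.reverse else u).map some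

/-- The interpretation of the nonterminals by languages for which every rule is valid. -/
def wordLang : WordNT → Language (Option Letter)
  | .start => monoidWordProblem (PresentedMonoid.of piTwoRel)
  | .null s => {w | ∃ u, w = encode s u ∧ toPi u = 1}
  | .core s => {w | ∃ u n, w = encode s u ∧ 1 ≤ n ∧
      toPi u = toPi (coreWord n)}
  | .inner s => {w | ∃ u n, w = encode s u ∧
      toPi u = toPi (coreWord n)}

lemma toPi_wrap_core {n : ℕ} (hn : 1 ≤ n) : toPi [.a] * toPi (coreWord n) * toPi [.c] = 1 := by
  rw [← toPi_block_mul_self hn]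
  simp only [← toPi_append]
  rw [block_append_block]
  rfl

/-- Words with the shape of the right-hand side `null x n y null` of a rule, where the language of
the nonterminal `n` consists of the encodings of words with property `P`. -/
lemma exists_of_mem_wrap {s : Bool} {n : WordNT} {x y : Letter} {P : List Letter → Prop}
    (hn : ∀ z ∈ wordLang n, ∃ v, z = encode s v ∧ P v) {z : List (Option Letter)}
    (hz : z ∈ ([.nonterminal (.null s), letterSym (if s then y else x), .nonterminal n,
      letterSym (if s then x else y), .nonterminal (.null s)].map (symbolLang wordLang)).prod) :
    ∃ u v, z = encode s u ∧ P v ∧ toPi u = toPi [x] * toPi v * toPi [y] := by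
  simp only [List.map_cons, List.map_nil, List.prod_cons, List.prod_nil, mul_one,
    Language.mem_mul] at hz
  obtain ⟨_, ⟨e, rfl, he⟩, _, ⟨_, rfl, _, ⟨_, hz, _, ⟨_, rfl, _, ⟨e', rfl, he'⟩, rfl⟩, rfl⟩, rfl⟩,
    rfl⟩ := hz
  obtain ⟨v, rfl, hv⟩ := hn _ hz
  cases s
  · refine ⟨e ++ x :: (v ++ y :: e'), v, by simp [encode], hv, ?_⟩
    simp only [toPi_append, toPi_cons, toPi_nil, he, he', one_mul, mul_one, mul_assoc]
  · refine ⟨e' ++ x :: (v ++ y :: e), v, by simp [encode], hv, ?_⟩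
    simp only [toPi_append, toPi_cons, toPi_nil, he, he', one_mul, mul_one, mul_assoc]

lemma directedRules_sound (s : Bool) : ∀ r ∈ directedRules s,
    (r.output.map (symbolLang wordLang)).prod ≤ wordLang r.input := by
  simp only [directedRules, List.forall_mem_cons, List.not_mem_nil, false_imp_iff, implies_true,
    and_true]
  refine ⟨?_, ?_, ?_, ?_, ?_⟩
  · rintro z rfl
    exact ⟨[], by simp [encode], rfl⟩
  · intro z hz
    obtain ⟨u, v, rfl, ⟨n, hn, hv⟩, hu⟩ :=
      exists_of_mem_wrap (s := s) (n := .core s) (x := .a) (y := .c)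
        (P := fun v => ∃ n, 1 ≤ n ∧ toPi v = toPi (coreWord n))
        (fun _ ⟨v, n, hz, hv⟩ => ⟨v, hz, n, hv⟩) hz
    exact ⟨u, rfl, by rw [hu, hv, toPi_wrap_core hn]⟩
  · intro z hz
    obtain ⟨u, v, rfl, ⟨n, hv⟩, hu⟩ :=
      exists_of_mem_wrap (s := s) (n := .inner s) (x := .b) (y := .b)
        (P := fun v => ∃ n, toPi v = toPi (coreWord n))
        (fun _ ⟨v, n, hz, hv⟩ => ⟨v, hz, n, hv⟩) (by rwa [ite_self])
    exact ⟨u, n + 1, rfl, by omega, by rw [hu, hv, coreWord_succ]; rfl⟩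
  · intro z hz
    simp only [List.map_cons, List.map_nil, List.prod_cons, List.prod_nil, mul_one] at hz
    obtain ⟨u, n, rfl, -, hu⟩ := hz
    exact ⟨u, n, rfl, hu⟩
  · intro z hz
    obtain ⟨u, v, rfl, hv, hu⟩ :=
      exists_of_mem_wrap (s := s) (n := .null s) (x := .c) (y := .a)
        (fun _ h => h) hz
    exact ⟨u, 0, rfl, by rw [hu, hv, mul_one]; rfl⟩

lemma letterRule_sound (x : Letter) :
    ((letterRule x).output.map (symbolLang wordLang)).prod ≤ wordLang .start := by
  intro z hz
  simp only [letterRule, List.map_cons, List.map_nil, List.prod_cons, List.prod_nil, mul_one] at hz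
  obtain ⟨_, rfl, _, ⟨_, ⟨u, v, huv, rfl⟩, _, rfl, rfl⟩, rfl⟩ := hz
  exact ⟨x :: u, x :: v, by simp [huv], by simp⟩

lemma startRules_sound : ∀ r ∈ startRules,
    (r.output.map (symbolLang wordLang)).prod ≤ wordLang r.input := by
  simp only [startRules, List.forall_mem_cons, List.not_mem_nil, false_imp_iff, implies_true,
    and_true]
  refine ⟨?_, ?_, letterRule_sound _, letterRule_sound _, letterRule_sound _⟩
  · intro z hz
    simp only [List.map_cons, List.map_nil, List.prod_cons, List.prod_nil, mul_one] at hz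
    obtain rfl : z = [none] := hz
    exact ⟨[], [], rfl, rfl⟩
  · intro z hz
    simp only [List.map_cons, List.map_nil, List.prod_cons, List.prod_nil, mul_one] at hz
    obtain ⟨_, ⟨e, rfl, he⟩, _, ⟨_, ⟨u, v, huv, rfl⟩, _, ⟨e', rfl, he'⟩, rfl⟩, rfl⟩ := hz
    refine ⟨e ++ u, e' ++ v, ?_, by simp [encode]⟩
    rw [prod_map_of, prod_map_of] at huv ⊢
    rw [toPi_append, toPi_append, he, he', huv]

lemma wordGrammar_language_le :
    wordGrammar.language ≤ monoidWordProblem (PresentedMonoid.of piTwoRel) :=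
  ContextFreeGrammar.language_le_of_rules wordLang fun r hr => by
    rcases mem_wordGrammar_rules.mp hr with hr | ⟨s, hr⟩
    · exact startRules_sound r hr
    · exact directedRules_sound s r hr

lemma yields_null_nil (s : Bool) : wordGrammar.Yields [.nonterminal (.null s)] [] :=
  .rule (mem_wordGrammar_rules.mpr (.inr ⟨s, .head _⟩)) .nil

/-- Words with the shape of the right-hand side `null x n y null` of a rule. -/
lemma yields_wrap {s : Bool} {m n : WordNT} {x y : Letter} {u v w : List Letter}
    (hr : ⟨m, [.nonterminal (.null s), letterSym (if s then y else x), .nonterminal n,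
      letterSym (if s then x else y), .nonterminal (.null s)]⟩ ∈ directedRules s)
    (hu : wordGrammar.Yields [.nonterminal (.null s)] (encode s u))
    (hv : wordGrammar.Yields [.nonterminal n] (encode s v))
    (hw : wordGrammar.Yields [.nonterminal (.null s)] (encode s w)) :
    wordGrammar.Yields [.nonterminal m] (encode s (u ++ x :: (v ++ y :: w))) := by
  have h := (mem_wordGrammar_rules.mpr (.inr ⟨s, hr⟩))
  cases s
  · have := ContextFreeGrammar.Yields.rule h
      (hu.nonterminal (.terminal (some x) (hv.nonterminal (.terminal (some y) hw))))
    simpa [encode] using this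
  · have := ContextFreeGrammar.Yields.rule h
      (hw.nonterminal (.terminal (some y) (hv.nonterminal (.terminal (some x) hu))))
    simpa [encode] using this

/-- An expansion of `bⁿ c a bⁿ` is generated, as soon as all shorter words that rewrite to the empty
word are. -/
lemma yields_inner {s : Bool} {N : ℕ}
    (hnull : ∀ e : List Letter, e.length < N → Red e [] →
      wordGrammar.Yields [.nonterminal (.null s)] (encode s e))
    (n : ℕ) {u : List Letter} (hN : u.length < N)
    (hu : Expansion (coreWord n) u) :
    wordGrammar.Yields [.nonterminal (.inner s)] (encode s u) ∧
      (1 ≤ n → wordGrammar.Yields [.nonterminal (.core s)] (encode s u)) := by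
  induction n generalizing u with
  | zero =>
    obtain ⟨e, u, rfl, he, hu⟩ := hu.of_cons
    obtain ⟨e', e'', rfl, he', hu⟩ := hu.of_cons
    have he'' := hu.of_nil
    simp only [List.length_append, List.length_cons] at hN
    refine ⟨yields_wrap (by cases s <;> simp [directedRules, openLetter, closeLetter])
      (hnull e (by omega) he) (hnull e' (by omega) he') (hnull e'' (by omega) he''), by simp⟩
  | succ n ih =>
    rw [coreWord_succ] at hu
    obtain ⟨e, u, rfl, he, hu⟩ := hu.of_cons
    obtain ⟨e', u, rfl, he', hu⟩ := hu.of_concat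
    simp only [List.length_append, List.length_cons] at hN
    have hcore : wordGrammar.Yields [.nonterminal (.core s)]
        (encode s (e ++ .b :: (u ++ .b :: e'))) :=
      yields_wrap (by cases s <;> simp [directedRules])
        (hnull e (by omega) he) (ih (by omega) hu).1 (hnull e' (by omega) he')
    exact ⟨.rule (mem_wordGrammar_rules.mpr (.inr ⟨s, core_rule_mem s⟩)) hcore,
      fun _ => hcore⟩

lemma yields_null (s : Bool) {u : List Letter} (hu : Red u []) :
    wordGrammar.Yields [.nonterminal (.null s)] (encode s u) := by
  induction h : u.length using Nat.strong_induction_on generalizing u with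
  | _ N ih =>
    rcases hu.cases_tail with rfl | ⟨z, huz, hz⟩
    · simpa [encode] using yields_null_nil s
    · generalize hnil : ([] : List Letter) = v at hz
      obtain ⟨i, hi, p, q⟩ := hz
      obtain ⟨rfl, rfl⟩ : p = [] ∧ q = [] := by simpa using hnil.symm
      rw [List.nil_append, List.append_nil, block_append_block] at huz
      obtain ⟨e, u, rfl, he, hu⟩ := (Red.expansion huz).of_cons
      obtain ⟨e', u, rfl, he', hu⟩ := hu.of_concat
      simp only [List.length_append, List.length_cons] at h
      exact yields_wrap (by cases s <;> simp [directedRules, openLetter, closeLetter])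
        (ih _ (by omega) he rfl)
        ((yields_inner (fun e h he => ih _ h he rfl) i (by omega) hu).2 hi)
        (ih _ (by omega) he' rfl)

lemma yields_start {w u v : List Letter} (hu : Expansion w u) (hv : Expansion w v) :
    wordGrammar.Yields [.nonterminal .start] (u.map some ++ none :: v.reverse.map some) := by
  have hpad {e e' : List Letter} {z : List (Option Letter)} (he : Red e []) (he' : Red e' [])
      (hz : wordGrammar.Yields [.nonterminal .start] z) :
      wordGrammar.Yields [.nonterminal .start] (e.map some ++ (z ++ e'.reverse.map some)) :=
    .rule (mem_wordGrammar_rules.mpr (.inl (.tail _ (.head _))))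
      ((yields_null false he).nonterminal (hz.nonterminal (yields_null true he')))
  induction w generalizing u v with
  | nil =>
    have h : wordGrammar.Yields [.nonterminal .start] [none] :=
      .rule (mem_wordGrammar_rules.mpr (.inl (.head _))) (.terminal none .nil)
    simpa using hpad hu.of_nil hv.of_nil h
  | cons x w ih =>
    obtain ⟨e, u, rfl, he, hu⟩ := hu.of_cons
    obtain ⟨e', v, rfl, he', hv⟩ := hv.of_cons
    have h : wordGrammar.Yields [.nonterminal .start]
        (some x :: ((u.map some ++ none :: v.reverse.map some) ++ [some x])) :=
      .rule (mem_wordGrammar_rules.mpr (.inl (letterRule_mem x)))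
        (.terminal _ ((ih hu hv).nonterminal (.terminal _ .nil)))
    simpa using hpad he he' h

lemma wordGrammar_language :
    wordGrammar.language = monoidWordProblem (PresentedMonoid.of piTwoRel) := by
  refine le_antisymm wordGrammar_language_le ?_
  rintro _ ⟨u, v, huv, rfl⟩
  rw [prod_map_of, prod_map_of] at huv
  obtain ⟨d, hu, hv⟩ := toPi_eq_iff_join.mp huv
  exact yields_start hu.expansion hv.expansion

theorem theoremB :
    (monoidWordProblem (PresentedMonoid.of piTwoRel)).IsContextFree ∧
    IsContextFreeMonoid PiTwo ∧
    (∀ (e : PiTwo) (he : IsIdempotentElem e), Nonempty (MaximalSubgroup he ≃* PiTwoˣ)) ∧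
    ¬ Group.FG PiTwoˣ ∧
    (∀ (e : PiTwo) (he : IsIdempotentElem e), ¬ Group.FG (MaximalSubgroup he)) := by
  have hcf : (monoidWordProblem (PresentedMonoid.of piTwoRel)).IsContextFree :=
    ⟨wordGrammar, wordGrammar_language⟩
  have hmax (e : PiTwo) (he : IsIdempotentElem e) : Nonempty (MaximalSubgroup he ≃* PiTwoˣ) := by
    obtain ⟨p, q, hpq, rfl⟩ := exists_eq_mul_of_isIdempotentElem he
    exact ⟨Units.mapEquiv (cornerEquiv he hpq).symm⟩
  have hfin : Finite Letter :=
    Set.finite_univ_iff.mp (Set.toFinite {Letter.a, Letter.b, Letter.c} |>.subset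
      fun x _ => by cases x <;> simp)
  refine ⟨hcf, ⟨Letter, hfin, _, PresentedMonoid.closure_range_of _, hcf⟩, hmax, not_fg_units, ?_⟩
  intro e he hfg
  obtain ⟨φ⟩ := hmax e he
  exact not_fg_units (Group.fg_of_surjective (f := φ.toMonoidHom) φ.surjective)
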